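/- Let $\mathcal{A}$ and $\mathcal{B}$ be abelian categories with enough projective objects, with full subcategories of projective objects $\mathcal{P}_{\mathcal{A}}$ and $\mathcal{P}_{\mathcal{B}}$. Let $F : D^b(\mathcal{A}) \to D^b(\mathcal{B})$ be a triangle functor that is non-negative, that is: (1) for every $X \in \mathcal{A}$ the complex $F(X)$ has zero homology in all negative degrees; (2) for every $P \in \mathcal{P}_{\mathcal{A}}$ the object $F(P)$ is isomorphic to a bounded complex of projective objects of $\mathcal{B}$ with zero terms in all negative degrees. The stable category $\underline{\mathcal{A}}$ has the objects of $\mathcal{A}$, and its morphisms are the morphisms of $\mathcal{A}$ modulo those that factor through a projective object; write $\underline{f}$ for the class of $f$. Then for every $X \in \mathcal{A}$ there is a distinguished triangle $$U_X \to F(X) \xrightarrow{\pi_X} M_X \to U_X[1]$$ in $D^b(\mathcal{B})$ with $M_X \in \mathcal{B}$ and with $U_X$ isomorphic to a complex of projective objects of $\mathcal{B}$ concentrated in degrees $1, \dots, n_X$ for some $n_X > 0$. Fix any choice of such triangles, one for each $X$. The stable functor $\bar F : \underline{\mathcal{A}} \to \underline{\mathcal{B}}$ is given by $\bar F(X) =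 M_X$ and $\bar F(\underline{f}) = \underline{b}$ for $f : X \to Y$, where $b : M_X \to M_Y$ is any morphism with $b \circ \pi_X = \pi_Y \circ F(f)$. Let $\Sigma : \underline{\mathcal{A}} \to D^b(\mathcal{A})/K^b(\mathcal{P}_{\mathcal{A}})$ and $\Sigma : \underline{\mathcal{B}} \to D^b(\mathcal{B})/K^b(\mathcal{P}_{\mathcal{B}})$ be the canonical functors to the Verdier quotients induced by the embeddings $\mathcal{A} \hookrightarrow D^b(\mathcal{A})$ and $\mathcal{B} \hookrightarrow D^b(\mathcal{B})$, and denote again by $F$ the functor $D^b(\mathcal{A})/K^b(\mathcal{P}_{\mathcal{A}}) \to D^b(\mathcal{B})/K^b(\mathcal{P}_{\mathcal{B}})$ induced by $F$. Then there is an isomorphism of functors $$F \circ \Sigma \;\cong\; \Sigma \circ \bar F : \underline{\mathcal{A}} \to D^b(\mathcal{B})/K^b(\mathcal{P}_{\mathcal{B}}).$$ -/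

import Mathlib

open CategoryTheory Limits Pretriangulated Triangulated

universe w v u w' v' u'

namespace StableFun

section ProjectiveComplexes

variable {C : Type u} [Category.{v} C] [Abelian C] [HasDerivedCategory.{w} C]

/-- The objects of the derived category of `C` that are isomorphic to a complex
`0 ⟶ P^a ⟶ ⋯ ⟶ P^b ⟶ 0` of projective objects placed in degrees `a, …, b`. -/
def IsProjIn (a b : ℤ) : ObjectProperty (DerivedCategory C) := fun X =>
  ∃ K : CochainComplex C ℤ, K.IsStrictlyGE a ∧ K.IsStrictlyLE b ∧
    (∀ i : ℤ, Projective (K.X i)) ∧ Nonempty (X ≅ DerivedCategory.Q.obj K)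

lemma IsProjIn.of_iso {a b : ℤ} {X Y : DerivedCategory C} (h : IsProjIn a b X) (e : X ≅ Y) :
    IsProjIn a b Y := by
  obtain ⟨K, h₁, h₂, h₃, ⟨e'⟩⟩ := h
  exact ⟨K, h₁, h₂, h₃, ⟨e.symm ≪≫ e'⟩⟩

lemma IsProjIn.mono {a b a' b' : ℤ} {X : DerivedCategory C} (h : IsProjIn a b X)
    (ha : a' ≤ a) (hb : b ≤ b') : IsProjIn a' b' X := by
  obtain ⟨K, h₁, h₂, h₃, e⟩ := h
  exact ⟨K, K.isStrictlyGE_of_ge _ _ ha, K.isStrictlyLE_of_le _ _ hb, h₃, e⟩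

lemma IsProjIn.shift {a b : ℤ} {X : DerivedCategory C} (h : IsProjIn a b X) (n : ℤ) :
    IsProjIn (a - n) (b - n) (X⟦n⟧) := by
  obtain ⟨K, h₁, h₂, h₃, ⟨e⟩⟩ := h
  refine ⟨K⟦n⟧, K.isStrictlyGE_shift a n _ (by lia), K.isStrictlyLE_shift b n _ (by lia),
    fun i => h₃ (i + n),
    ⟨(shiftFunctor _ n).mapIso e ≪≫ (DerivedCategory.Q.commShiftIso n).symm.app K⟩⟩

lemma isProjIn_of_isZero {a b : ℤ} {X : DerivedCategory C} (h : IsZero X) : IsProjIn a b X := by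
  have h0 : IsZero (HomologicalComplex.zero : CochainComplex C ℤ) :=
    HomologicalComplex.isZero_zero
  have h0' (i : ℤ) : IsZero ((HomologicalComplex.zero : CochainComplex C ℤ).X i) :=
    (HomologicalComplex.eval C (ComplexShape.up ℤ) i).map_isZero h0
  refine ⟨HomologicalComplex.zero, ?_, ?_, fun i => ?_,
    ⟨h.iso (DerivedCategory.Q.map_isZero h0)⟩⟩
  · rw [CochainComplex.isStrictlyGE_iff]
    exact fun i _ => h0' i
  · rw [CochainComplex.isStrictlyLE_iff]
    exact fun i _ => h0' i
  · exact (h0' i).projective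

/-- A morphism in the derived category out of a bounded above complex of projective objects
is represented by a morphism of complexes. -/
lemma exists_Q_map_eq (K L : CochainComplex C ℤ) (b : ℤ) [K.IsStrictlyLE b]
    (hK : ∀ i : ℤ, Projective (K.X i))
    (f : DerivedCategory.Q.obj K ⟶ DerivedCategory.Q.obj L) :
    ∃ φ : K ⟶ L, DerivedCategory.Q.map φ = f := by
  have : K.IsKProjective := CochainComplex.isKProjective_of_projective K b
  obtain ⟨g, hg⟩ := (CochainComplex.IsKProjective.Qh_map_bijective K
    ((HomotopyCategory.quotient C _).obj L)).2
    ((DerivedCategory.quotientCompQhIso C).hom.app K ≫ f ≫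
      (DerivedCategory.quotientCompQhIso C).inv.app L)
  obtain ⟨φ, rfl⟩ := (HomotopyCategory.quotient C _).map_surjective g
  refine ⟨φ, ?_⟩
  have := DerivedCategory.quotientCompQhIso_hom_naturality φ
  rw [hg] at this
  simpa using this.symm

lemma IsProjIn.cone {a b : ℤ} {T : Triangle (DerivedCategory C)}
    (hT : T ∈ distTriang (DerivedCategory C))
    (h₁ : IsProjIn (a + 1) (b + 1) T.obj₁) (h₂ : IsProjIn a b T.obj₂) :
    IsProjIn a b T.obj₃ := by
  obtain ⟨K, hK₁, hK₂, hK₃, ⟨e⟩⟩ := h₁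
  obtain ⟨L, hL₁, hL₂, hL₃, ⟨e'⟩⟩ := h₂
  obtain ⟨φ, hφ⟩ := exists_Q_map_eq K L (b + 1) hK₃ (e.inv ≫ T.mor₁ ≫ e'.hom)
  have e₃ := Triangle.π₃.mapIso (isoTriangleOfIso₁₂ T _ hT
    (DerivedCategory.mappingCone_triangle_distinguished φ) e e' (by
      change _ = e.hom ≫ DerivedCategory.Q.map φ
      rw [hφ, Iso.hom_inv_id_assoc]
      rfl))
  refine ⟨CochainComplex.mappingCone φ, ?_, ?_, fun i => ?_, ⟨e₃⟩⟩
  · rw [CochainComplex.isStrictlyGE_iff]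
    intro i hi
    refine HomologicalComplex.homotopyCofiber.isZero_X φ i (L.isZero_of_isStrictlyGE a i) ?_
    rintro j rfl
    exact K.isZero_of_isStrictlyGE (a + 1) _
  · rw [CochainComplex.isStrictlyLE_iff]
    intro i hi
    refine HomologicalComplex.homotopyCofiber.isZero_X φ i (L.isZero_of_isStrictlyLE b i) ?_
    rintro j rfl
    exact K.isZero_of_isStrictlyLE (b + 1) _
  · have := hK₃
    have := hL₃
    exact Projective.of_iso (HomologicalComplex.homotopyCofiber.XIsoBiprod φ i (i + 1) rfl).symm
      inferInstance

lemma IsProjIn.ext {a b : ℤ} {T : Triangle (DerivedCategory C)}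
    (hT : T ∈ distTriang (DerivedCategory C))
    (h₁ : IsProjIn a b T.obj₁) (h₃ : IsProjIn a b T.obj₃) :
    IsProjIn a b T.obj₂ := by
  have h := IsProjIn.cone (a := a - 1) (b := b - 1) (rot_of_distTriang _ (rot_of_distTriang _ hT))
    (h₃.mono (by lia) (by lia)) (h₁.shift 1)
  exact ((h.shift (-1)).mono (by lia) (by lia)).of_iso (shiftShiftNeg T.obj₂ (1 : ℤ))

lemma isProjIn_zero_single {P : C} (hP : Projective P) (n : ℤ) :
    IsProjIn n n ((DerivedCategory.singleFunctor C n).obj P) := by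
  refine ⟨(CochainComplex.singleFunctor C n).obj P, inferInstance, inferInstance, fun i => ?_,
    ⟨(DerivedCategory.singleFunctorIsoCompQ C n).app P⟩⟩
  by_cases hi : i = n
  · exact hP.of_iso (HomologicalComplex.singleObjXIsoOfEq _ n P i hi).symm
  · exact (HomologicalComplex.isZero_single_obj_X _ n P i hi).projective

lemma IsProjIn.eq_zero_of_pos {b : ℤ} {X : DerivedCategory C} (hX : IsProjIn 1 b X) {M : C}
    (f : X ⟶ (DerivedCategory.singleFunctor C 0).obj M) : f = 0 := by
  obtain ⟨K, h₁, h₂, h₃, ⟨e⟩⟩ := hX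
  obtain ⟨φ, hφ⟩ := exists_Q_map_eq K ((HomologicalComplex.single C (ComplexShape.up ℤ) 0).obj M) b h₃
    (e.inv ≫ f)
  have : φ = 0 := HomologicalComplex.to_single_hom_ext
    ((K.isZero_of_isStrictlyGE 1 0).eq_of_src _ _)
  rw [← cancel_epi e.inv, comp_zero]
  exact hφ.symm.trans (by rw [this, Functor.map_zero]; rfl)

/-- A morphism from a complex of projective objects in degrees `≥ 0` to an object of `C` placed in
degree zero factors through a projective object placed in degree zero. -/
lemma IsProjIn.exists_fac {b : ℤ} {X : DerivedCategory C} (hX : IsProjIn 0 b X) {M : C}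
    (f : X ⟶ (DerivedCategory.singleFunctor C 0).obj M) :
    ∃ (P : C) (_ : Projective P) (α : X ⟶ (DerivedCategory.singleFunctor C 0).obj P) (β : P ⟶ M),
      f = α ≫ (DerivedCategory.singleFunctor C 0).map β := by
  obtain ⟨K, h₁, h₂, h₃, ⟨e⟩⟩ := hX
  obtain ⟨φ, hφ⟩ := exists_Q_map_eq K ((HomologicalComplex.single C (ComplexShape.up ℤ) 0).obj M) b h₃
    (e.inv ≫ f)
  let ψ : K ⟶ (HomologicalComplex.single C (ComplexShape.up ℤ) 0).obj (K.X 0) :=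
    HomologicalComplex.mkHomToSingle (𝟙 _) (fun i hi =>
      (K.isZero_of_isStrictlyGE 0 i (by simp at hi; lia)).eq_of_src _ _)
  let β : K.X 0 ⟶ M := φ.f 0 ≫ (HomologicalComplex.singleObjXSelf (ComplexShape.up ℤ) 0 M).hom
  have hψ : φ = ψ ≫ (HomologicalComplex.single C (ComplexShape.up ℤ) 0).map β :=
    HomologicalComplex.to_single_hom_ext (by
      simp [ψ, β, HomologicalComplex.single_map_f_self])
  let ψ' : DerivedCategory.Q.obj K ⟶ (DerivedCategory.singleFunctor C 0).obj (K.X 0) :=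
    DerivedCategory.Q.map ψ
  have h : e.inv ≫ f = ψ' ≫ (DerivedCategory.singleFunctor C 0).map β :=
    hφ.symm.trans (by rw [hψ, Functor.map_comp]; rfl)
  refine ⟨K.X 0, h₃ 0, e.hom ≫ ψ', β, ?_⟩
  rw [Category.assoc, ← h, Iso.hom_inv_id_assoc]

/-- Every nonzero complex of projective objects is an extension of a shorter one by a projective
object in its top degree. -/
lemma exists_triangle (K : CochainComplex C ℤ) (a b : ℤ) [K.IsStrictlyGE a] [K.IsStrictlyLE b]
    (hK : ∀ i : ℤ, Projective (K.X i)) :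
    ∃ (Y : DerivedCategory C)
      (f : (DerivedCategory.singleFunctor C b).obj (K.X b) ⟶ DerivedCategory.Q.obj K)
      (g : DerivedCategory.Q.obj K ⟶ Y)
      (h : Y ⟶ ((DerivedCategory.singleFunctor C b).obj (K.X b))⟦(1 : ℤ)⟧),
      Triangle.mk f g h ∈ distTriang (DerivedCategory C) ∧ IsProjIn a (b - 1) Y := by
  let f : (HomologicalComplex.single C (ComplexShape.up ℤ) b).obj (K.X b) ⟶ K :=
    HomologicalComplex.mkHomFromSingle (𝟙 _) (fun i hi =>
      (K.isZero_of_isStrictlyLE b i (by simp at hi; lia)).eq_of_tgt _ _)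
  have hf (i : ℤ) : Mono (f.f i) := by
    by_cases hi : i = b
    · subst hi
      simp only [f, HomologicalComplex.mkHomFromSingle_f]
      infer_instance
    · exact ⟨fun _ _ _ => (HomologicalComplex.isZero_single_obj_X _ b (K.X b) i hi).eq_of_tgt _ _⟩
  have : Mono f := HomologicalComplex.mono_of_mono_f f hf
  let S : ShortComplex (CochainComplex C ℤ) := ShortComplex.mk f (cokernel.π f) (by simp)
  have hS : S.ShortExact :=
    { exact := S.exact_of_g_is_cokernel (cokernelIsCokernel f)
      mono_f := this
      epi_g := by dsimp [S]; infer_instance }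
  have hSi (i : ℤ) := hS.map_of_exact (HomologicalComplex.eval C (ComplexShape.up ℤ) i)
  have hb : IsZero (S.X₃.X b) := by
    have h1 : Epi (S.map (HomologicalComplex.eval C (ComplexShape.up ℤ) b)).f := by
      change Epi (f.f b)
      simp only [f, HomologicalComplex.mkHomFromSingle_f]
      infer_instance
    have h2 := (hSi b).mono_f
    exact (hSi b).isIso_f_iff.1 (isIso_of_mono_of_epi _)
  have hi (i : ℤ) (hi : i ≠ b) : IsIso (S.g.f i) :=
    (hSi i).isIso_g_iff.2 (HomologicalComplex.isZero_single_obj_X (ComplexShape.up ℤ) b (K.X b) i hi)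
  refine ⟨_, _, _, _, DerivedCategory.triangleOfSES_distinguished hS, S.X₃, ?_, ?_, ?_,
    ⟨Iso.refl _⟩⟩
  · rw [CochainComplex.isStrictlyGE_iff]
    intro i hia
    by_cases hib : i = b
    · exact hib ▸ hb
    · have := hi i hib
      exact (K.isZero_of_isStrictlyGE a i).of_iso (asIso (S.g.f i)).symm
  · rw [CochainComplex.isStrictlyLE_iff]
    intro i hia
    by_cases hib : i = b
    · exact hib ▸ hb
    · have := hi i hib
      exact (K.isZero_of_isStrictlyLE b i (by lia)).of_iso (asIso (S.g.f i)).symm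
  · intro i
    by_cases hib : i = b
    · exact (hib ▸ hb : IsZero (S.X₃.X i)).projective
    · have := hi i hib
      exact (hK i).of_iso (asIso (S.g.f i))

end ProjectiveComplexes

section StableCategory

set_option linter.unusedSectionVars false
open ZeroObject

variable (C : Type u) [Category.{v} C] [Abelian C]

variable {C} in
/-- A morphism that factors through a projective object. -/
def FactorsThroughProjective {X Y : C} (f : X ⟶ Y) : Prop :=
  ∃ (P : C) (_ : Projective P) (g : X ⟶ P) (h : P ⟶ Y), f = g ≫ h

namespace FactorsThroughProjective

variable {C}

lemma zero (X Y : C) : FactorsThroughProjective (0 : X ⟶ Y) :=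
  ⟨0, (isZero_zero C).projective, 0, 0, by simp⟩

lemma add {X Y : C} {f g : X ⟶ Y} (hf : FactorsThroughProjective f)
    (hg : FactorsThroughProjective g) : FactorsThroughProjective (f + g) := by
  obtain ⟨P, hP, a, b, rfl⟩ := hf
  obtain ⟨Q, hQ, c, d, rfl⟩ := hg
  exact ⟨P ⊞ Q, inferInstance, biprod.lift a c, biprod.desc b d, by simp⟩

lemma neg {X Y : C} {f : X ⟶ Y} (hf : FactorsThroughProjective f) :
    FactorsThroughProjective (-f) := by
  obtain ⟨P, hP, a, b, rfl⟩ := hf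
  exact ⟨P, hP, -a, b, by simp⟩

lemma comp_left {X Y Z : C} (f : X ⟶ Y) {g : Y ⟶ Z} (hg : FactorsThroughProjective g) :
    FactorsThroughProjective (f ≫ g) := by
  obtain ⟨P, hP, a, b, rfl⟩ := hg
  exact ⟨P, hP, f ≫ a, b, by simp⟩

lemma comp_right {X Y Z : C} {f : X ⟶ Y} (g : Y ⟶ Z) (hf : FactorsThroughProjective f) :
    FactorsThroughProjective (f ≫ g) := by
  obtain ⟨P, hP, a, b, rfl⟩ := hf
  exact ⟨P, hP, a, b ≫ g, by simp⟩

end FactorsThroughProjective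

/-- Two parallel morphisms are identified in the stable category when their difference factors
through a projective object. -/
def stableRel : HomRel C := fun _ _ f g => FactorsThroughProjective (f - g)

instance : Congruence (stableRel C) where
  equivalence :=
    { refl := fun f => by
        simpa [stableRel] using FactorsThroughProjective.zero _ _
      symm := fun {f g} h => by
        simpa [stableRel] using FactorsThroughProjective.neg h
      trans := fun {f g h} h₁ h₂ => by
        simpa [stableRel] using FactorsThroughProjective.add h₁ h₂ }
  comp_left f _ _ h := by
    simpa [stableRel] using FactorsThroughProjective.comp_left f h
  comp_right g h := by
    simpa [stableRel] using FactorsThroughProjective.comp_right g h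

/-- The stable category of `C`: the additive quotient of `C` by its projective objects. -/
abbrev StableCategory : Type u := CategoryTheory.Quotient (stableRel C)

/-- The canonical functor from `C` to its stable category. -/
abbrev toStable : C ⥤ StableCategory C := CategoryTheory.Quotient.functor (stableRel C)

instance : Preadditive (StableCategory C) :=
  CategoryTheory.Quotient.preadditive _ (fun _ _ f₁ f₂ g₁ g₂ h h' => by
    have := FactorsThroughProjective.add h h'
    rwa [← add_sub_add_comm] at this)

instance : (toStable C).Additive :=
  CategoryTheory.Quotient.functor_additive _ _

end StableCategory

section SingularityCategory

open ZeroObject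

variable (C : Type u) [Category.{v} C] [Abelian C] [HasDerivedCategory.{w} C]

/-- The embedding of `C` into its bounded derived category, as complexes concentrated in
degree zero. -/
noncomputable def single : C ⥤ DerivedCategory.Bounded C :=
  ObjectProperty.lift _ (DerivedCategory.singleFunctor C 0)
    (fun _ => ⟨⟨0, inferInstance⟩, ⟨0, inferInstance⟩⟩)

instance : (single C).Full where
  map_surjective f := by
    obtain ⟨g, hg⟩ := (DerivedCategory.singleFunctor C 0).map_surjective f.hom
    exact ⟨g, by ext; exact hg⟩

instance : (single C).Faithful where
  map_injective h :=
    (DerivedCategory.singleFunctor C 0).map_injective (congrArg (fun φ => φ.hom) h)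

instance : (single C).Additive where
  map_add {X Y f g} := by
    ext
    exact (DerivedCategory.singleFunctor C 0).map_add

/-- The full subcategory of the bounded derived category that consists of the complexes isomorphic
to bounded complexes of projective objects. -/
def kbProj : ObjectProperty (DerivedCategory.Bounded C) := fun X =>
  ∃ a b : ℤ, IsProjIn a b X.obj

variable {C} in
lemma kbProj_single {P : C} (hP : Projective P) : kbProj C ((single C).obj P) :=
  ⟨0, 0, isProjIn_zero_single hP 0⟩

instance : (kbProj C).IsClosedUnderIsomorphisms where
  of_iso e := by
    rintro ⟨a, b, h⟩
    exact ⟨a, b, h.of_iso ((DerivedCategory.Bounded.ι (C := C)).mapIso e)⟩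

instance : (kbProj C).IsTriangulated where
  exists_zero := ⟨0, isZero_zero _, 0, 0, isProjIn_of_isZero
    ((DerivedCategory.Bounded.ι (C := C)).map_isZero (isZero_zero _))⟩
  isStableUnderShiftBy n :=
    { le_shift := by
        rintro X ⟨a, b, h⟩
        exact ⟨_, _, (h.shift n).of_iso
          (((DerivedCategory.Bounded.ι (C := C)).commShiftIso n).symm.app X)⟩ }
  toIsTriangulatedClosed₂ := .mk' (by
    rintro T hT ⟨a, b, h⟩ ⟨a', b', h'⟩
    exact ⟨min a a', max b b', IsProjIn.ext
      ((DerivedCategory.Bounded.ι (C := C)).map_distinguished T hT)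
      (h.mono (by simp) (by simp)) (h'.mono (by simp) (by simp))⟩)

/-- The singularity category of `C`: the Verdier quotient of the bounded derived category by the
triangulated subcategory of bounded complexes of projective objects. -/
abbrev SingularityCategory := (kbProj C).trW.Localization

/-- The Verdier quotient functor. -/
noncomputable abbrev toSing : DerivedCategory.Bounded C ⥤ SingularityCategory C := (kbProj C).trW.Q

instance : (toSing C).Additive := inferInstance

variable {C} in
lemma toSing_isZero {X : DerivedCategory.Bounded C} (hX : kbProj C X) :
    IsZero ((toSing C).obj X) := by
  rw [IsZero.iff_id_eq_zero]
  have h : (kbProj C).trW (0 : X ⟶ 0) := by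
    rw [(kbProj C).trW_iff']
    exact ⟨X, 𝟙 X, 0, contractible_distinguished X, hX⟩
  have := Localization.inverts (toSing C) (kbProj C).trW _ h
  rw [← cancel_mono ((toSing C).map (0 : X ⟶ 0))]
  simp

/-- The canonical functor from the stable category to the singularity category, which is induced by
the embedding of `C` into its bounded derived category. -/
noncomputable def stableToSing : StableCategory C ⥤ SingularityCategory C :=
  CategoryTheory.Quotient.lift _ (single C ⋙ toSing C) (by
    rintro X Y f g ⟨P, hP, a, b, h⟩
    rw [← sub_eq_zero, ← Functor.map_sub, h, Functor.map_comp]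
    have h0 : (single C ⋙ toSing C).map a = 0 := (toSing_isZero (kbProj_single hP)).eq_of_tgt _ _
    rw [h0, zero_comp])

end SingularityCategory

section NonNegative

variable {A : Type u} [Category.{v} A] [Abelian A] [HasDerivedCategory.{w} A]
  {B : Type u'} [Category.{v'} B] [Abelian B] [HasDerivedCategory.{w'} B]
  (F : DerivedCategory.Bounded A ⥤ DerivedCategory.Bounded B)

/-- A non-negative functor: it sends objects of `A` to complexes with zero homology in all negative
degrees, and projective objects of `A` to bounded complexes of projective objects with zero terms
in all negative degrees. -/
structure IsNonNegative : Prop where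
  isZero_homology : ∀ (X : A) (i : ℤ), i < 0 →
    IsZero ((DerivedCategory.homologyFunctor B i).obj (F.obj ((single A).obj X)).obj)
  isProjIn : ∀ P : A, Projective P → ∃ n : ℤ, IsProjIn 0 n (F.obj ((single A).obj P)).obj

variable {F} [F.CommShift ℤ]

lemma IsNonNegative.kbProj_single_shift (hF : IsNonNegative F) {P : A} (hP : Projective P)
    (X : DerivedCategory.Bounded A) (b : ℤ)
    (e : X.obj ≅ (DerivedCategory.singleFunctor A b).obj P) : kbProj B (F.obj X) := by
  obtain ⟨n, hn⟩ := hF.isProjIn P hP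
  have h : kbProj B (F.obj ((single A).obj P)) := ⟨0, n, hn⟩
  let e' : X ≅ ((single A).obj P)⟦-b⟧ := (DerivedCategory.Bounded.ι (C := A)).preimageIso
    (e ≪≫ (((DerivedCategory.singleFunctors A).shiftIso (-b) b 0 (by simp)).symm.app P) ≪≫
      ((DerivedCategory.Bounded.ι (C := A)).commShiftIso (-b)).symm.app ((single A).obj P))
  exact (kbProj B).prop_of_iso ((F.mapIso e') ≪≫ (F.commShiftIso (-b)).app _).symm
    ((kbProj B).le_shift (-b) _ h)

variable [F.IsTriangulated]

lemma IsNonNegative.kbProj_obj (hF : IsNonNegative F) {X : DerivedCategory.Bounded A}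
    (hX : kbProj A X) : kbProj B (F.obj X) := by
  obtain ⟨a, b, hX⟩ := hX
  obtain ⟨n, hn⟩ : ∃ n : ℕ, b < a + n := ⟨(b - a + 1).toNat, by lia⟩
  induction n generalizing b X with
  | zero =>
    obtain ⟨K, h₁, h₂, h₃, ⟨e⟩⟩ := hX
    refine (kbProj B).prop_of_isZero (F.map_isZero ?_)
    have hK : IsZero K := by
      rw [IsZero.iff_id_eq_zero]
      ext i
      refine IsZero.eq_of_src ?_ _ _
      by_cases hi : i < a
      · exact K.isZero_of_isStrictlyGE a i
      · exact K.isZero_of_isStrictlyLE b i (by simp at hn; lia)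
    have : IsZero ((DerivedCategory.Bounded.ι (C := A)).obj X) :=
      (DerivedCategory.Q.map_isZero hK).of_iso e
    rw [IsZero.iff_id_eq_zero]
    ext
    exact this.eq_of_src _ _
  | succ n ih =>
    obtain ⟨K, h₁, h₂, h₃, ⟨e⟩⟩ := hX
    obtain ⟨Y, f, g, h, hT, hY⟩ := exists_triangle K a b h₃
    have hY' : DerivedCategory.TStructure.t.bounded Y := by
      obtain ⟨L, hL₁, hL₂, -, ⟨e'⟩⟩ := hY
      exact ⟨⟨a, ⟨L, e', hL₁⟩⟩, ⟨b - 1, ⟨L, e', hL₂⟩⟩⟩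
    let S : DerivedCategory.Bounded A :=
      ⟨(DerivedCategory.singleFunctor A b).obj (K.X b), ⟨b, inferInstance⟩, ⟨b, inferInstance⟩⟩
    let Y₀ : DerivedCategory.Bounded A := ⟨Y, hY'⟩
    let ι := DerivedCategory.Bounded.ι (C := A)
    let T : Triangle (DerivedCategory.Bounded A) :=
      Triangle.mk (ObjectProperty.homMk (X := S) (Y := X) (f ≫ e.inv))
        (ObjectProperty.homMk (X := X) (Y := Y₀) (e.hom ≫ g))
        (ObjectProperty.homMk (X := Y₀) (Y := S⟦(1 : ℤ)⟧)
          (h ≫ (ι.commShiftIso (1 : ℤ)).inv.app S))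
    have hT' : T ∈ distTriang _ := by
      change ι.mapTriangle.obj T ∈ distTriang _
      refine isomorphic_distinguished _ hT _
        (Triangle.isoMk _ _ (Iso.refl _) e (Iso.refl _) ?_ ?_ ?_)
      · change (f ≫ e.inv) ≫ e.hom = 𝟙 _ ≫ f
        simp
      · change (e.hom ≫ g) ≫ 𝟙 _ = e.hom ≫ g
        simp
      · change ((h ≫ (ι.commShiftIso (1 : ℤ)).inv.app S) ≫ (ι.commShiftIso (1 : ℤ)).hom.app S) ≫
          (𝟙 _)⟦(1 : ℤ)⟧' = 𝟙 _ ≫ h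
        simp
        exact Category.comp_id h
    exact (kbProj B).ext_of_isTriangulatedClosed₂ _ (F.map_distinguished T hT')
      (hF.kbProj_single_shift (h₃ b) S b (Iso.refl _)) 
      (ih (X := Y₀) (b - 1) hY (by push_cast at hn; lia))

lemma IsNonNegative.isInvertedBy (hF : IsNonNegative F) :
    (kbProj A).trW.IsInvertedBy (F ⋙ toSing B) := by
  rintro X Y f ⟨Z, g, h, hT, hZ⟩
  exact Localization.inverts (toSing B) (kbProj B).trW _
    (ObjectProperty.trW.mk _ (F.map_distinguished _ hT) (hF.kbProj_obj hZ))

/-- The functor between singularity categories induced by a non-negative triangle functor. -/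
noncomputable def IsNonNegative.singFunctor (hF : IsNonNegative F) :
    SingularityCategory A ⥤ SingularityCategory B :=
  Localization.lift (F ⋙ toSing B) hF.isInvertedBy (toSing A)

end NonNegative

section StableFunctor

variable {A : Type u} [Category.{v} A] [Abelian A] [HasDerivedCategory.{w} A]
  {B : Type u'} [Category.{v'} B] [Abelian B] [HasDerivedCategory.{w'} B]

/-- A choice, for each object `X` of `A`, of a distinguished triangle
`U X ⟶ F X ⟶ M X ⟶ (U X)⟦1⟧` in the bounded derived category of `B`, where `M X` is an object of
`B` and `U X` is a complex of projective objects in degrees `1, …, n` for some `n > 0`. -/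
structure StableTriangles (F : DerivedCategory.Bounded A ⥤ DerivedCategory.Bounded B) where
  U : A → DerivedCategory.Bounded B
  M : A → B
  ι : ∀ X : A, U X ⟶ F.obj ((single A).obj X)
  π : ∀ X : A, F.obj ((single A).obj X) ⟶ (single B).obj (M X)
  μ : ∀ X : A, (single B).obj (M X) ⟶ (U X)⟦(1 : ℤ)⟧
  distinguished : ∀ X : A,
    Triangle.mk (ι X) (π X) (μ X) ∈ distTriang (DerivedCategory.Bounded B)
  isProjIn_U : ∀ X : A, ∃ n : ℤ, 0 < n ∧ IsProjIn 1 n (U X).obj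

lemma factorsThroughProjective_of_fac {M N : B} {b : M ⟶ N} {V : DerivedCategory.Bounded B}
    {n : ℤ} (hV : IsProjIn 0 n V.obj) (u : (single B).obj M ⟶ V) (g : V ⟶ (single B).obj N)
    (h : (single B).map b = u ≫ g) : FactorsThroughProjective b := by
  obtain ⟨P, hP, α, β, hg⟩ := hV.exists_fac (M := N) g.hom
  have hg' : g = ObjectProperty.homMk (Y := (single B).obj P) α ≫ (single B).map β := by
    ext
    exact hg
  refine ⟨P, hP, (single B).preimage (u ≫ ObjectProperty.homMk (Y := (single B).obj P) α), β, ?_⟩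
  apply (single B).map_injective
  rw [h, hg']
  simp

namespace StableTriangles

variable {F : DerivedCategory.Bounded A ⥤ DerivedCategory.Bounded B} (ξ : StableTriangles F)

lemma exists_map {X Y : A} (f : X ⟶ Y) :
    ∃ b : ξ.M X ⟶ ξ.M Y,
      ξ.π X ≫ (single B).map b = F.map ((single A).map f) ≫ ξ.π Y := by
  obtain ⟨n, -, hn⟩ := ξ.isProjIn_U X
  have h0 : ξ.ι X ≫ F.map ((single A).map f) ≫ ξ.π Y = 0 := by
    ext
    exact hn.eq_zero_of_pos _
  obtain ⟨g, hg⟩ := Triangle.yoneda_exact₂ _ (ξ.distinguished X) _ h0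
  obtain ⟨b, rfl⟩ := (single B).map_surjective g
  exact ⟨b, hg.symm⟩

lemma factorsThroughProjective {X : A} {N : B} (b : ξ.M X ⟶ N)
    (h : ξ.π X ≫ (single B).map b = 0) : FactorsThroughProjective b := by
  obtain ⟨n, -, hn⟩ := ξ.isProjIn_U X
  obtain ⟨g, hg⟩ := Triangle.yoneda_exact₃ _ (ξ.distinguished X) _ h
  refine factorsThroughProjective_of_fac (n := n - 1) (V := (ξ.U X)⟦(1 : ℤ)⟧) ?_ _ _ hg
  exact (hn.shift 1).of_iso
    (((DerivedCategory.Bounded.ι (C := B)).commShiftIso (1 : ℤ)).symm.app (ξ.U X))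

/-- A morphism `b` with `π_X b = F(f) π_Y`. -/
noncomputable def lift {X Y : A} (f : X ⟶ Y) : ξ.M X ⟶ ξ.M Y := (ξ.exists_map f).choose

lemma π_lift {X Y : A} (f : X ⟶ Y) :
    ξ.π X ≫ (single B).map (ξ.lift f) = F.map ((single A).map f) ≫ ξ.π Y :=
  (ξ.exists_map f).choose_spec

lemma toStable_map_eq {X : A} {N : B} {b b' : ξ.M X ⟶ N}
    (h : ξ.π X ≫ (single B).map b = ξ.π X ≫ (single B).map b') :
    (toStable B).map b = (toStable B).map b' :=
  CategoryTheory.Quotient.sound _ (ξ.factorsThroughProjective (b - b') (by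
    rw [Functor.map_sub, Preadditive.comp_sub, h, sub_self]))

/-- The assignment `X ↦ M X` is a functor with values in the stable category of `B`. -/
noncomputable def preStableFunctor : A ⥤ StableCategory B where
  obj X := (toStable B).obj (ξ.M X)
  map f := (toStable B).map (ξ.lift f)
  map_id X := by
    rw [← (toStable B).map_id]
    exact ξ.toStable_map_eq (by simp [π_lift])
  map_comp {X Y Z} f g := by
    rw [← (toStable B).map_comp]
    refine ξ.toStable_map_eq ?_
    rw [π_lift, Functor.map_comp (single B), ← Category.assoc, π_lift, Category.assoc, π_lift]
    simp

lemma projective_M (hF : IsNonNegative F) {P : A} (hP : Projective P) : Projective (ξ.M P) := by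
  obtain ⟨n, -, hn⟩ := ξ.isProjIn_U P
  obtain ⟨m, hm⟩ := hF.isProjIn P hP
  have h : IsProjIn 0 (max n m) ((single B).obj (ξ.M P)).obj := IsProjIn.cone
    ((DerivedCategory.Bounded.ι (C := B)).map_distinguished _ (ξ.distinguished P))
    (hn.mono (by simp) (by lia)) (hm.mono (by simp) (by simp))
  obtain ⟨Q, hQ, g, h, hfac⟩ := factorsThroughProjective_of_fac (b := 𝟙 (ξ.M P)) h (𝟙 _) (𝟙 _)
    (by simp)
  exact (Retract.mk g h hfac.symm).projective

variable [F.CommShift ℤ] [F.IsTriangulated]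

/-- The stable functor of a non-negative triangle functor `F`, for a choice of triangles: it sends
`X` to `M X` and the class of a morphism `f` to the class of any morphism `b` such that
`π_X b = F(f) π_Y`. -/
noncomputable def stableFunctor (hF : IsNonNegative F) : StableCategory A ⥤ StableCategory B :=
  CategoryTheory.Quotient.lift _ ξ.preStableFunctor (by
    rintro X Y f g ⟨P, hP, a, b, h⟩
    have hP' := ξ.projective_M hF hP
    have h₁ : (toStable B).map (ξ.lift a ≫ ξ.lift b) = 0 := by
      rw [← (toStable B).map_zero]
      exact CategoryTheory.Quotient.sound _ ⟨ξ.M P, hP', ξ.lift a, ξ.lift b, by simp⟩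
    have h₂ : (toStable B).map (ξ.lift f) =
        (toStable B).map (ξ.lift g + ξ.lift a ≫ ξ.lift b) := by
      refine ξ.toStable_map_eq ?_
      have hf : f = g + a ≫ b := by rw [← h]; simp
      have h₃ : ξ.π X ≫ (single B).map (ξ.lift a) ≫ (single B).map (ξ.lift b) =
          F.map ((single A).map a) ≫ F.map ((single A).map b) ≫ ξ.π Y := by
        rw [← Category.assoc, π_lift, Category.assoc, π_lift]
      rw [π_lift, Functor.map_add, Functor.map_comp, Preadditive.comp_add, π_lift, h₃, hf]
      simp
    change (toStable B).map (ξ.lift f) = (toStable B).map (ξ.lift g)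
    rw [h₂, Functor.map_add, h₁, add_zero])

end StableTriangles

end StableFunctor

end StableFun

/-! In the Verdier quotient by bounded complexes of projectives, any morphism whose cone or fibre is
such a complex becomes invertible. The fibre of `π X` is `U X`, so the images of the `π X` are
isomorphisms from the image of `F X` to the image of `M X`. Their naturality is the equation
`π_lift` that characterises the chosen lift of a morphism. This gives `stableToSingIso`, whatever
the choice of triangles.

The substance lies in the existence of the triangles. By the first non-negativity condition and
boundedness, `F X` has homology only in degrees `0, …, n`. If `n > 0`, the top homology is covered
by a projective placed in degree `n` (`exists_single_epi_homology`), and passing to the cone of this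
cover leaves homology in degrees `0, …, n - 1`. After finitely many steps only an object in degree
zero is left, and the octahedral axiom shows that the projectives used assemble into the cone of the
composite map (`exists_triangle_single`). Shifting this cone by `-1` gives `U X`. -/

namespace StableFun

/-! ### Killing homology from the top with projectives -/

section ProjectiveApproximation

variable {C : Type u} [Category.{v} C] [Abelian C] [HasDerivedCategory.{w} C]

/-- A bounded above complex receives a morphism from a projective object placed in its top degree
that is surjective on the top homology. -/
lemma exists_single_epi_homology [EnoughProjectives C] (Z : DerivedCategory C) (n : ℤ)
    [Z.IsLE n] :
    ∃ (P : C) (_ : Projective P) (f : (DerivedCategory.singleFunctor C n).obj P ⟶ Z),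
      Epi ((DerivedCategory.homologyFunctor C n).map f) := by
  obtain ⟨K, hK, ⟨e⟩⟩ := Z.exists_iso_Q_obj_of_isLE n
  let φ : (HomologicalComplex.single C (ComplexShape.up ℤ) n).obj (Projective.over (K.X n)) ⟶ K :=
    HomologicalComplex.mkHomFromSingle (Projective.π (K.X n)) (fun i hi =>
      (K.isZero_of_isStrictlyLE n i (by simp at hi; lia)).eq_of_tgt _ _)
  have hφ : Epi (φ.f n) := by
    simp only [φ, HomologicalComplex.mkHomFromSingle_f]
    infer_instance
  -- In the top degree every element is a cycle, for `K` and for the single complex alike.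
  -- Surjectivity of `φ` in degree `n` therefore passes to cycles, and then to homology as a
  -- quotient of cycles.
  have hi := K.isIso_iCycles n (n + 1) (by simp)
    ((K.isZero_of_isStrictlyLE n (n + 1) (by lia)).eq_of_tgt _ _)
  have hi' := ((HomologicalComplex.single C (ComplexShape.up ℤ) n).obj
    (Projective.over (K.X n))).isIso_iCycles n (n + 1) (by simp) (by simp)
  have hc : Epi (HomologicalComplex.cyclesMap φ n) := by
    have h := HomologicalComplex.cyclesMap_i φ n
    rw [← IsIso.eq_comp_inv] at h
    rw [h]
    infer_instance
  have hh : Epi (HomologicalComplex.homologyMap φ n) := by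
    have h : Epi (HomologicalComplex.cyclesMap φ n ≫ K.homologyπ n) := inferInstance
    rw [← HomologicalComplex.homologyπ_naturality] at h
    exact epi_of_epi (HomologicalComplex.homologyπ _ n) (HomologicalComplex.homologyMap φ n)
  let f : (DerivedCategory.singleFunctor C n).obj (Projective.over (K.X n)) ⟶
    DerivedCategory.Q.obj K := DerivedCategory.Q.map φ
  have hf : Epi ((DerivedCategory.homologyFunctor C n).map f) := by
    have h := DerivedCategory.homologyFunctorFactors_hom_naturality φ n
    have h' := (IsIso.eq_comp_inv ((DerivedCategory.homologyFunctorFactors C n).hom.app K)).2 h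
    change Epi ((DerivedCategory.homologyFunctor C n).map (DerivedCategory.Q.map φ))
    rw [h']
    exact epi_comp' (epi_comp' inferInstance hh) inferInstance
  refine ⟨_, Projective.projective_over _, f ≫ e.inv, ?_⟩
  rw [Functor.map_comp]
  infer_instance

/-- An object of the derived category with homology in degrees `0, …, n` is sent to an object of `C`
with a cone which is a complex of projective objects in degrees `0, …, n`. -/
lemma exists_triangle_single [EnoughProjectives C] (n : ℕ) (Z : DerivedCategory C) [Z.IsGE 0]
    [Z.IsLE n] :
    ∃ (M : C) (W : DerivedCategory C) (p : Z ⟶ (DerivedCategory.singleFunctor C 0).obj M)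
      (q : (DerivedCategory.singleFunctor C 0).obj M ⟶ W) (r : W ⟶ Z⟦(1 : ℤ)⟧),
      Triangle.mk p q r ∈ distTriang (DerivedCategory C) ∧ IsProjIn 0 n W := by
  induction n generalizing Z with
  | zero =>
    -- Homology in degree zero alone means that `Z` is already an object of `C`, so the cone can be
    -- taken to be zero.
    obtain ⟨M, ⟨e⟩⟩ := Z.exists_iso_singleFunctor_obj_of_isGE_of_isLE 0
    refine ⟨M, _, e.hom, 0, 0, isomorphic_distinguished _ (contractible_distinguished Z) _
      (Triangle.isoMk _ _ (Iso.refl _) e.symm (Iso.refl _)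
        (e.hom_inv_id.trans (Category.comp_id _).symm) (zero_comp.trans comp_zero.symm)
        (zero_comp.trans comp_zero.symm)), isProjIn_of_isZero (isZero_zero _)⟩
  | succ n ih =>
    obtain ⟨P, hP, f, hf⟩ := exists_single_epi_homology Z ((n + 1 : ℕ) : ℤ)
    obtain ⟨Z', g, h, hT⟩ := distinguished_cocone_triangle f
    -- Exactness of `H^i(Z) ⟶ H^i(Z') ⟶ H^(i+1)` of the projective placed in degree `n + 1`.
    have h₃ (i : ℤ) (hi : IsZero ((DerivedCategory.homologyFunctor C (i + 1)).obj
        ((DerivedCategory.singleFunctor C ((n + 1 : ℕ) : ℤ)).obj P)))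
        (hg : (DerivedCategory.homologyFunctor C i).map g = 0) :
        IsZero ((DerivedCategory.homologyFunctor C i).obj Z') :=
      (DerivedCategory.HomologySequence.exact₃ _ hT i (i + 1)).isZero_of_both_zeros hg
        (hi.eq_of_tgt _ _)
    have hGE : Z'.IsGE 0 := by
      rw [DerivedCategory.isGE_iff]
      intro i hi
      -- For `i < 0` one has `i + 1 ≤ 0 < n + 1`. A projective placed in degree `0` would fail here
      -- at `i = -1`, which is why the induction stops at homology in degree zero.
      exact h₃ i (DerivedCategory.isZero_of_isGE _ ((n + 1 : ℕ) : ℤ) _ (by lia))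
        ((DerivedCategory.isZero_of_isGE Z 0 i hi).eq_of_src _ _)
    have hLE : Z'.IsLE n := by
      rw [DerivedCategory.isLE_iff]
      intro i hi
      refine h₃ i (DerivedCategory.isZero_of_isLE _ ((n + 1 : ℕ) : ℤ) _ (by lia)) ?_
      by_cases hin : i = ((n + 1 : ℕ) : ℤ)
      · subst hin
        -- The purpose of the cover: surjectivity of `f` on the top homology makes `g` vanish there.
        exact (DerivedCategory.HomologySequence.epi_homologyMap_mor₁_iff _ hT _).1 hf
      · exact (DerivedCategory.isZero_of_isLE Z ((n + 1 : ℕ) : ℤ) i (by lia)).eq_of_src _ _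
    obtain ⟨M, W', p, q, r, hT', hW'⟩ := ih Z'
    obtain ⟨W, q', r', hT''⟩ := distinguished_cocone_triangle (g ≫ p)
    -- The cone of `g` is the projective shifted by one, hence placed in degree `n`, and the cone of
    -- `p` is `W'`. The octahedron exhibits `W` as an extension of the second by the first.
    let o := someOctahedron rfl (rot_of_distTriang _ hT) hT' hT''
    refine ⟨M, W, g ≫ p, q', r', hT'', IsProjIn.ext o.mem ?_ (hW'.mono le_rfl (by simp))⟩
    exact ((isProjIn_zero_single hP ((n + 1 : ℕ) : ℤ)).shift 1).mono (by simp) (by simp)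

end ProjectiveApproximation

/-! ### Existence of the triangles and the comparison isomorphism -/

section StableFunctor

variable {A : Type u} [Category.{v} A] [Abelian A] [HasDerivedCategory.{w} A]
  {B : Type u'} [Category.{v'} B] [Abelian B] [HasDerivedCategory.{w'} B]
  {F : DerivedCategory.Bounded A ⥤ DerivedCategory.Bounded B}

/-- An object of the bounded derived category with homology in non-negative degrees fits in a
triangle as in `StableTriangles`. -/
lemma exists_stableTriangle [EnoughProjectives B] (Z : DerivedCategory.Bounded B)
    (hZ : Z.obj.IsGE 0) :
    ∃ (U : DerivedCategory.Bounded B) (M : B) (i : U ⟶ Z) (p : Z ⟶ (single B).obj M)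
      (m : (single B).obj M ⟶ U⟦(1 : ℤ)⟧),
      Triangle.mk i p m ∈ distTriang (DerivedCategory.Bounded B) ∧
        ∃ n : ℤ, 0 < n ∧ IsProjIn 1 n U.obj := by
  obtain ⟨b, hb⟩ := Z.property.2
  -- The upper bound `b` may be negative, while the induction runs over natural numbers.
  obtain ⟨n, hn⟩ : ∃ n : ℕ, b ≤ n := ⟨b.toNat, by lia⟩
  have : Z.obj.IsLE n := DerivedCategory.TStructure.t.isLE_of_le Z.obj b n hn
  obtain ⟨M, W, p, q, r, hT, hW⟩ := exists_triangle_single n Z.obj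
  obtain ⟨U, i, m, hT'⟩ := distinguished_cocone_triangle₁
    (ObjectProperty.homMk p : Z ⟶ (single B).obj M)
  -- The shift `U⟦1⟧` will be identified with `W`, which lives in degrees `0, …, n`; hence `U` lives
  -- in degrees `1, …, n + 1`.
  refine ⟨U, M, i, _, m, hT', n + 1, by lia, ?_⟩
  have hι := (DerivedCategory.Bounded.ι (C := B)).map_distinguished _ hT'
  -- The fibre `U` was formed in the bounded category. Rotating its triangle and comparing cones of
  -- `p` in the full derived category gives `U⟦1⟧ ≅ W`.
  let e := isoTriangleOfIso₁₂ _ _ (rot_of_distTriang _ hι) hT (Iso.refl _) (Iso.refl _) (by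
    refine (Category.comp_id _).trans (Eq.trans ?_ (Category.id_comp _).symm)
    rfl)
  have hU := ((hW.of_iso (Triangle.π₃.mapIso e).symm).shift (-1)).mono (a' := 1) (b' := n + 1)
    (by simp) (by simp)
  exact hU.of_iso (shiftShiftNeg U.obj (1 : ℤ))

lemma IsNonNegative.nonempty_stableTriangles [EnoughProjectives B] (hF : IsNonNegative F) :
    Nonempty (StableTriangles F) := by
  have h (X : A) := exists_stableTriangle (F.obj ((single A).obj X))
    ((DerivedCategory.isGE_iff _ _).2 (hF.isZero_homology X))
  choose U M i p m hT hU using h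
  exact ⟨⟨U, M, i, p, m, hT, hU⟩⟩

/-- The fibre of `π X` is a bounded complex of projectives, so `π X` belongs to the class of
morphisms inverted by the Verdier quotient. -/
lemma StableTriangles.isIso_toSing_map_π (ξ : StableTriangles F) (X : A) :
    IsIso ((toSing B).map (ξ.π X)) := by
  obtain ⟨n, -, hn⟩ := ξ.isProjIn_U X
  exact Localization.inverts (toSing B) (kbProj B).trW _
    (ObjectProperty.trW.mk' _ (ξ.distinguished X) ⟨1, n, hn⟩)

/-- The morphisms `π X` induce an isomorphism between the functor on singularity categories and the
stable functor. -/
noncomputable def StableTriangles.stableToSingIso (ξ : StableTriangles F)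
    [F.CommShift ℤ] [F.IsTriangulated] (hF : IsNonNegative F) :
    stableToSing A ⋙ hF.singFunctor ≅ ξ.stableFunctor hF ⋙ stableToSing B :=
  -- The stable category is a quotient of `A` with the same objects, so an isomorphism of functors
  -- on it can be built after restriction to `A`. There `Localization.fac` replaces the induced
  -- functor by `F` itself.
  CategoryTheory.Quotient.natIsoLift _
    (Functor.isoWhiskerLeft (single A)
      (Localization.fac (F ⋙ toSing B) hF.isInvertedBy (toSing A)) ≪≫
    NatIso.ofComponents (F := single A ⋙ F ⋙ toSing B)
      (G := toStable A ⋙ ξ.stableFunctor hF ⋙ stableToSing B)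
      (fun X =>
        have := ξ.isIso_toSing_map_π X
        show (toSing B).obj (F.obj ((single A).obj X)) ≅ (toSing B).obj ((single B).obj (ξ.M X))
          from asIso ((toSing B).map (ξ.π X)))
      (fun {X Y} f => by
        -- The naturality square is the image of one that already commutes in the bounded derived
        -- category, by the defining property of `ξ.lift f`.
        change (toSing B).map (F.map ((single A).map f)) ≫ (toSing B).map (ξ.π Y) =
          (toSing B).map (ξ.π X) ≫ (toSing B).map ((single B).map (ξ.lift f))
        rw [← Functor.map_comp, ← Functor.map_comp, ξ.π_lift]))

end StableFunctor

end StableFun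
theorem mainTheorem11
    {A : Type u} [Category.{v} A] [Abelian A] [EnoughProjectives A] [HasDerivedCategory.{w} A]
    {B : Type u'} [Category.{v'} B] [Abelian B] [EnoughProjectives B] [HasDerivedCategory.{w'} B]
    (F : DerivedCategory.Bounded A ⥤ DerivedCategory.Bounded B)
    [F.CommShift ℤ] [F.IsTriangulated] (hF : StableFun.IsNonNegative F) :
    Nonempty (StableFun.StableTriangles F) ∧
      ∀ ξ : StableFun.StableTriangles F,
        Nonempty (StableFun.stableToSing A ⋙ hF.singFunctor ≅
          ξ.stableFunctor hF ⋙ StableFun.stableToSing B) :=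
  ⟨hF.nonempty_stableTriangles, fun ξ => ⟨ξ.stableToSingIso hF⟩⟩
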